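/- Let $E$ and $F$ be equivalence relations on $\omega$. We say that $E$ is finitarily reducible to $F$ if there are functions $f_k:\omega^k\to\omega^k$, $k\in\omega$, computable uniformly in $k$ (that is, $\vec x\mapsto f_{|\vec x|}(\vec x)$ is a computable function $\omega^{<\omega}\to\omega^{<\omega}$, with no oracle), such that whenever $f_k(x_0,\dots,x_{k-1})=(y_0,\dots,y_{k-1})$ and $i<j<k$, we have $x_i\mathrel{E}x_j\iff y_i\mathrel{F}y_j$. An equivalence relation is finitarily complete for a class $\Gamma$ if it belongs to $\Gamma$ and every equivalence relation on $\omega$ in $\Gamma$ is finitarily reducible to it. For $X\subseteq\omega$ let $W_e^X=\mathrm{dom}(\Phi_e^X)$ be the $e$-th set c.e. in $X$, let $W_e$ be the $e$-th c.e. set, and let $\emptyset^{(n)}$ be the $n$-th Turing jump of $\emptyset$. Then: 1. The relation $i=^{ce}j\iff W_i=W_j$ is finitarily complete for $\Pi^0_2$. 2. For every $X\subseteq\omega$, the relation $i\mathrel{E^X_=}j\iff W_i^X=W_j^X$ is finitarily complete for $\Pi^X_2$ (by reductions which are computable, not merely $X$-computable). 3. For every $n\in\omega$, the relation $i\mathrel{E^n_=}j\iff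 W_i^{\emptyset^{(n)}}=W_j^{\emptyset^{(n)}}$ is finitarily complete for $\Pi^0_{n+2}$. -/

import Mathlib

namespace FinitaryReducibility

/-! ### Oracle programs, computably enumerable sets relative to an oracle, and the jump -/

/-- Programs for partial functions on `ℕ` that may query an oracle. These are the programs
`Nat.Partrec.Code` of Mathlib together with one additional instruction `oracle`. -/
inductive OracleCode : Type
  | zero : OracleCode
  | succ : OracleCode
  | left : OracleCode
  | right : OracleCode
  | oracle : OracleCode
  | pair : OracleCode → OracleCode → OracleCode
  | comp : OracleCode → OracleCode → OracleCode
  | prec : OracleCode → OracleCode → OracleCode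
  | rfind' : OracleCode → OracleCode

namespace OracleCode

/-- The number of a program. -/
def encodeCode : OracleCode → ℕ
  | zero => 0
  | succ => 1
  | left => 2
  | right => 3
  | oracle => 4
  | pair cf cg => 2 * (2 * Nat.pair (encodeCode cf) (encodeCode cg)) + 5
  | comp cf cg => 2 * (2 * Nat.pair (encodeCode cf) (encodeCode cg) + 1) + 5
  | prec cf cg => (2 * (2 * Nat.pair (encodeCode cf) (encodeCode cg)) + 1) + 5
  | rfind' cf => (2 * (2 * encodeCode cf + 1) + 1) + 5

/-- The program with a given number. -/
def ofNatCode : ℕ → OracleCode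
  | 0 => zero
  | 1 => succ
  | 2 => left
  | 3 => right
  | 4 => oracle
  | n + 5 =>
    let m := n.div2.div2
    have hm : m < n + 5 := by
      simp only [m, Nat.div2_val]
      exact
        lt_of_le_of_lt (le_trans (Nat.div_le_self _ _) (Nat.div_le_self _ _))
          (Nat.succ_le_succ (Nat.le_add_right _ _))
    have _m1 : m.unpair.1 < n + 5 := lt_of_le_of_lt m.unpair_left_le hm
    have _m2 : m.unpair.2 < n + 5 := lt_of_le_of_lt m.unpair_right_le hm
    match n.bodd, n.div2.bodd with
    | false, false => pair (ofNatCode m.unpair.1) (ofNatCode m.unpair.2)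
    | false, true => comp (ofNatCode m.unpair.1) (ofNatCode m.unpair.2)
    | true, false => prec (ofNatCode m.unpair.1) (ofNatCode m.unpair.2)
    | true, true => rfind' (ofNatCode m)
  termination_by n => n
  decreasing_by
    · exact _m1
    · exact _m2
    · exact _m1
    · exact _m2
    · exact _m1
    · exact _m2
    · exact hm

theorem encode_ofNatCode : ∀ n, encodeCode (ofNatCode n) = n
  | 0 => by simp [ofNatCode, encodeCode]
  | 1 => by simp [ofNatCode, encodeCode]
  | 2 => by simp [ofNatCode, encodeCode]
  | 3 => by simp [ofNatCode, encodeCode]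
  | 4 => by simp [ofNatCode, encodeCode]
  | n + 5 => by
    let m := n.div2.div2
    have hm : m < n + 5 := by
      simp only [m, Nat.div2_val]
      exact
        lt_of_le_of_lt (le_trans (Nat.div_le_self _ _) (Nat.div_le_self _ _))
          (Nat.succ_le_succ (Nat.le_add_right _ _))
    have _m1 : m.unpair.1 < n + 5 := lt_of_le_of_lt m.unpair_left_le hm
    have _m2 : m.unpair.2 < n + 5 := lt_of_le_of_lt m.unpair_right_le hm
    have IH := encode_ofNatCode m
    have IH1 := encode_ofNatCode m.unpair.1
    have IH2 := encode_ofNatCode m.unpair.2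
    conv_rhs => rw [← Nat.bit_bodd_div2 n, ← Nat.bit_bodd_div2 n.div2]
    simp only [ofNatCode.eq_6]
    cases n.bodd <;> cases n.div2.bodd <;>
      simp [m, encodeCode, IH, IH1, IH2, Nat.bit_val]
  termination_by n => n
  decreasing_by
    · exact hm
    · exact _m1
    · exact _m2

/-- The numbering of programs is an effective bijection of the programs with `ℕ`. -/
instance instDenumerable : Denumerable OracleCode :=
  Denumerable.mk'
    ⟨encodeCode, ofNatCode, fun c => by
        induction c <;> simp [encodeCode, ofNatCode, Nat.div2_val, *],
      encode_ofNatCode⟩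

/-- The partial function computed by a program with oracle `g`. The clauses other than `oracle`
are those of `Nat.Partrec.Code.eval`; `rfind'` on input `Nat.pair a m` searches for the least
`n ≥ m` with `eval g cf (Nat.pair a n) = 0`, all earlier values being defined. -/
def eval (g : ℕ → ℕ) : OracleCode → ℕ →. ℕ
  | zero => pure 0
  | succ => Nat.succ
  | left => ↑fun n : ℕ => n.unpair.1
  | right => ↑fun n : ℕ => n.unpair.2
  | oracle => ↑g
  | pair cf cg => fun n => Nat.pair <$> eval g cf n <*> eval g cg n
  | comp cf cg => fun n => eval g cg n >>= eval g cf
  | prec cf cg =>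
    Nat.unpaired fun a n =>
      n.rec (eval g cf a) fun y IH => do
        let i ← IH
        eval g cg (Nat.pair a (Nat.pair y i))
  | rfind' cf =>
    Nat.unpaired fun a m =>
      (Nat.rfind fun n => (fun m => m = 0) <$> eval g cf (Nat.pair a (n + m))).map (· + m)

end OracleCode

open Classical in
/-- The characteristic function of a set of natural numbers. -/
noncomputable def charFun (X : Set ℕ) : ℕ → ℕ := fun n => if n ∈ X then 1 else 0

/-- The partial function `Φ_e^X`. -/
noncomputable def Phi (X : Set ℕ) (e : ℕ) : ℕ →. ℕ :=
  OracleCode.eval (charFun X) (Denumerable.ofNat OracleCode e)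

/-- `W_e^X`, the domain of `Φ_e^X`. -/
def WIn (X : Set ℕ) (e : ℕ) : Set ℕ := (Phi X e).Dom

/-- `W_e`, the domain of the `e`-th partial computable function. -/
def W (e : ℕ) : Set ℕ :=
  (Nat.Partrec.Code.eval (Denumerable.ofNat Nat.Partrec.Code e)).Dom

/-- The Turing jump `X'`. -/
def jump (X : Set ℕ) : Set ℕ := {e | e ∈ WIn X e}

/-- The iterated jump `∅^(n)` of the empty set. -/
def emptyJump : ℕ → Set ℕ
  | 0 => ∅
  | n + 1 => jump (emptyJump n)

/-! ### Equality of c.e. sets as a relation on indices -/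

/-- Equality of c.e. sets, `i =^ce j`. -/
def CeEq (i j : ℕ) : Prop := W i = W j

/-- `E_=^X`: equality of the sets c.e. in `X`. -/
def CeEqIn (X : Set ℕ) (i j : ℕ) : Prop := WIn X i = WIn X j

/-- `E_=^n`: equality of the sets c.e. in `∅^(n)`. -/
def CeEqLevel (n : ℕ) : ℕ → ℕ → Prop := CeEqIn (emptyJump n)

/-! ### The arithmetical hierarchy, plain and relative to an oracle -/

/-- The `Σ_n` sets over a given class `C` of "computable" sets: `Σ_0` is `C`, and `A` is
`Σ_(n+1)` if `A = {x | ∃ y, ⟨x, y⟩ ∈ B}` for some `B` whose complement is `Σ_n`. -/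
def SigmaOver (C : Set ℕ → Prop) : ℕ → Set ℕ → Prop
  | 0, A => C A
  | n + 1, A => ∃ B : Set ℕ, SigmaOver C n Bᶜ ∧ A = {x | ∃ y, Nat.pair x y ∈ B}

/-- The `Π_n` sets over `C`: the complements of the `Σ_n` sets over `C`. -/
def PiOver (C : Set ℕ → Prop) (n : ℕ) (A : Set ℕ) : Prop := SigmaOver C n Aᶜ

/-- A binary relation on `ℕ`, as the set of codes of its pairs. -/
def relSet (R : ℕ → ℕ → Prop) : Set ℕ := {p | R p.unpair.1 p.unpair.2}

/-- `R` is `Π^0_n`. -/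
def IsPi (n : ℕ) (R : ℕ → ℕ → Prop) : Prop :=
  PiOver (fun A => ComputablePred fun x => x ∈ A) n (relSet R)

/-- `R` is `Π^X_n`. -/
def IsPiIn (X : Set ℕ) (n : ℕ) (R : ℕ → ℕ → Prop) : Prop :=
  PiOver (fun A => TuringReducible (charFun A) (charFun X)) n (relSet R)

/-! ### Finitary reducibility -/

/-- `f` satisfies the reduction condition of an `n`-ary reduction from `E` to `F`. -/
def IsNaryReduction (E F : ℕ → ℕ → Prop) (n : ℕ)
    (f : List.Vector ℕ n → List.Vector ℕ n) : Prop :=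
  ∀ (x : List.Vector ℕ n) (i j : Fin n), i < j →
    (E (x.get i) (x.get j) ↔ F ((f x).get i) ((f x).get j))

/-- `E` is finitarily reducible to `F`: there are `n`-ary reductions `f n` for all `n`, computable
uniformly in `n` (that is, computable as one function from finite sequences to finite sequences).
The function is computable without any oracle. -/
def FinitarilyReducible (E F : ℕ → ℕ → Prop) : Prop :=
  ∃ f : (n : ℕ) → List.Vector ℕ n → List.Vector ℕ n,
    Computable (fun x : List ℕ => (f x.length ⟨x, rfl⟩).toList) ∧
      ∀ n, IsNaryReduction E F n (f n)

/-- `E` is complete among the equivalence relations on `ℕ` in the class `C` under finitary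
reducibility: it is such a relation, and every such relation is finitarily reducible to it. -/
def FinitarilyComplete (C : (ℕ → ℕ → Prop) → Prop) (E : ℕ → ℕ → Prop) : Prop :=
  Equivalence E ∧ C E ∧
    ∀ R : ℕ → ℕ → Prop, Equivalence R → C R → FinitarilyReducible R E

end FinitaryReducibility

/-! Upper bound: `WIn X i = WIn X j` holds iff for all `x` and `s` the approximations to the two
sets agree on `x` at some stage past `s`, which is a `Π₂` condition over `X`.

Hardness: let `R a b` mean `∀ y, ∃ w, (a, b, y, w) ∈ D` with `D` computable in `X`. Say that `a, b`
agree up to `n` if witnesses `w` exist for all `y < n`; this is an event c.e. in `X`. To the entry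
`x` of a finite list `L` assign the set of all pairs `(S, n)` such that `x ∈ S`, or some `a ∈ S` and
`b ∈ L \ S` agree up to `n`. The second clause does not depend on `x`. If `R x x'` and `S` separates
`x` from `x'`, that clause puts `(S, n)` into both sets, so the sets are equal. If `R x x'` fails,
let `S` be the class of `x` inside `L`, and let `n` exceed a point of disagreement for every
unrelated pair from `L`: the second clause fails, so `(S, n)` is in the set of `x` but not in that
of `x'`. Finiteness of `L` is what makes such an `n` exist. The oracle is used only by the
enumerations; their indices come from the s-m-n construction (`exists_index`), so the reduction is
computable outright.

For iterated jumps, Post's theorem (`sigmaOver_succ_succ_iff`) trades each jump for a quantifier,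
identifying `Π⁰_{n+2}` with `Π₂` over `∅^(n)`. For the plain numbering `W`, indices are translated
to and from the numbering with empty oracle.

Oracle computations are handled through finite initial segments: the use principle together with
`HaltsOn`, a primitive recursive predicate of a finite list. -/

namespace FinitaryReducibility

open Encodable Denumerable Primrec
open Nat.Partrec (Code)

/-! ### Oracle programs with partial oracles, and the use principle -/

namespace OracleCode

/-- The partial function computed by a program with a partial oracle `p`. -/
def evalP (p : ℕ →. ℕ) : OracleCode → ℕ →. ℕ
  | zero => pure 0
  | succ => Nat.succ
  | left => ↑fun n : ℕ => n.unpair.1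
  | right => ↑fun n : ℕ => n.unpair.2
  | oracle => p
  | pair cf cg => fun n => Nat.pair <$> evalP p cf n <*> evalP p cg n
  | comp cf cg => fun n => evalP p cg n >>= evalP p cf
  | prec cf cg =>
    Nat.unpaired fun a n =>
      n.rec (evalP p cf a) fun y IH => do
        let i ← IH
        evalP p cg (Nat.pair a (Nat.pair y i))
  | rfind' cf =>
    Nat.unpaired fun a m =>
      (Nat.rfind fun n => (fun m => m = 0) <$> evalP p cf (Nat.pair a (n + m))).map (· + m)

theorem evalP_coe (g : ℕ → ℕ) (c : OracleCode) : evalP (g : ℕ →. ℕ) c = eval g c := by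
  induction c <;> simp only [evalP, eval, *] <;> rfl

/-- Replace the oracle instruction by an ordinary program. -/
def toCode (q : Code) : OracleCode → Code
  | zero => .zero
  | succ => .succ
  | left => .left
  | right => .right
  | oracle => q
  | pair cf cg => .pair (toCode q cf) (toCode q cg)
  | comp cf cg => .comp (toCode q cf) (toCode q cg)
  | prec cf cg => .prec (toCode q cf) (toCode q cg)
  | rfind' cf => .rfind' (toCode q cf)

theorem eval_toCode (q : Code) (c : OracleCode) : (toCode q c).eval = evalP q.eval c := by
  induction c <;> simp only [evalP, toCode, Code.eval, *] <;> rfl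

theorem exists_forall_lt_of_forall_exists {P : ℕ → ℕ → Prop}
    (hP : ∀ i s t, s ≤ t → P i s → P i t) (n : ℕ) (h : ∀ i < n, ∃ s, P i s) :
    ∃ s, ∀ i < n, P i s := by
  induction n with
  | zero => exact ⟨0, by simp⟩
  | succ n ih =>
    obtain ⟨s, hs⟩ := ih fun i hi => h i (by omega)
    obtain ⟨t, ht⟩ := h n (by omega)
    refine ⟨max s t, fun i hi => ?_⟩
    rcases Nat.lt_succ_iff_lt_or_eq.1 hi with hi | rfl
    · exact hP _ _ _ (le_max_left _ _) (hs i hi)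
    · exact hP _ _ _ (le_max_right _ _) ht

/-- `p'` extends the restriction of `p` to arguments below `s`. -/
def ExtendsBelow (s : ℕ) (p p' : ℕ →. ℕ) : Prop := ∀ n < s, ∀ v ∈ p n, v ∈ p' n

theorem ExtendsBelow.mono {s t : ℕ} {p p' : ℕ →. ℕ} (hst : s ≤ t) (h : ExtendsBelow t p p') :
    ExtendsBelow s p p' := fun n hn => h n (hn.trans_le hst)

/-- The use principle: a halting computation depends on finitely many oracle values. -/
theorem evalP_use (p : ℕ →. ℕ) (c : OracleCode) :
    ∀ x, ∀ y ∈ evalP p c x, ∃ s, ∀ p', ExtendsBelow s p p' → y ∈ evalP p' c x := by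
  induction c with
  | zero => exact fun x y h => ⟨0, fun p' _ => h⟩
  | succ => exact fun x y h => ⟨0, fun p' _ => h⟩
  | left => exact fun x y h => ⟨0, fun p' _ => h⟩
  | right => exact fun x y h => ⟨0, fun p' _ => h⟩
  | oracle => exact fun x y h => ⟨x + 1, fun p' hp => hp x (by omega) y h⟩
  | pair cf cg hf hg =>
    intro x y h
    simp only [evalP, Seq.seq, Part.mem_bind_iff, Part.map_eq_map, Part.mem_map_iff] at h ⊢
    obtain ⟨_, ⟨a, ha, rfl⟩, b, hb, rfl⟩ := h
    obtain ⟨s, hs⟩ := hf x a ha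
    obtain ⟨t, ht⟩ := hg x b hb
    exact ⟨max s t, fun p' hp => ⟨_, ⟨a, hs p' (hp.mono (le_max_left _ _)), rfl⟩, b,
      ht p' (hp.mono (le_max_right _ _)), rfl⟩⟩
  | comp cf cg hf hg =>
    intro x y h
    obtain ⟨a, ha, hy⟩ := Part.mem_bind_iff.1 h
    obtain ⟨s, hs⟩ := hg x a ha
    obtain ⟨t, ht⟩ := hf a y hy
    exact ⟨max s t, fun p' hp => Part.mem_bind_iff.2 ⟨a, hs p' (hp.mono (le_max_left _ _)),
      ht p' (hp.mono (le_max_right _ _))⟩⟩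
  | prec cf cg hf hg =>
    intro x
    simp only [evalP, Nat.unpaired]
    generalize x.unpair.1 = a
    induction x.unpair.2 with
    | zero => exact hf a
    | succ n ih =>
      intro y h
      simp only [Part.bind_eq_bind, Part.mem_bind_iff] at h ⊢
      obtain ⟨i, hi, hy⟩ := h
      obtain ⟨s, hs⟩ := ih i hi
      obtain ⟨t, ht⟩ := hg _ y hy
      exact ⟨max s t, fun p' hp => ⟨i, hs p' (hp.mono (le_max_left _ _)),
        ht p' (hp.mono (le_max_right _ _))⟩⟩
  | rfind' cf hf =>
    intro x y h
    -- Stated for every oracle, so that it can be read off for `p` and then applied to `p'`: a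
    -- search that succeeds depends on only finitely many values of `cf`.
    have key : ∀ p n, n + x.unpair.2 = y → (y ∈ evalP p (rfind' cf) x ↔
        (∃ a ∈ evalP p cf (Nat.pair x.unpair.1 (n + x.unpair.2)), decide (a = 0) = true) ∧
        ∀ i < n, ∃ a ∈ evalP p cf (Nat.pair x.unpair.1 (i + x.unpair.2)),
          decide (a = 0) = false) := by
      intro p n hn
      simp only [evalP, Nat.unpaired, Part.mem_map_iff]
      constructor
      · rintro ⟨m, hm, hmy⟩
        obtain rfl : m = n := by omega
        obtain ⟨h₁, h₂⟩ := Nat.mem_rfind.1 hm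
        exact ⟨(Part.mem_map_iff _).1 h₁, fun i hi => (Part.mem_map_iff _).1 (h₂ hi)⟩
      · rintro ⟨h₁, h₂⟩
        exact ⟨n, Nat.mem_rfind.2 ⟨(Part.mem_map_iff _).2 h₁,
          fun hi => (Part.mem_map_iff _).2 (h₂ _ hi)⟩, hn⟩
    obtain ⟨n, -, hn⟩ := (Part.mem_map_iff _).1 h
    obtain ⟨⟨a, ha, ha0⟩, hlt⟩ := (key p n hn).1 h
    obtain ⟨s, hs⟩ := hf _ a ha
    obtain ⟨t, ht⟩ := exists_forall_lt_of_forall_exists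
      (P := fun i t => ∀ p', ExtendsBelow t p p' →
        ∃ a, a ∈ evalP p' cf (Nat.pair x.unpair.1 (i + x.unpair.2)) ∧ decide (a = 0) = false)
      (fun i s t hst H p' hp => H p' (hp.mono hst)) n (fun i hi => by
        obtain ⟨b, hb, hb0⟩ := hlt i hi
        obtain ⟨t, ht⟩ := hf _ b hb
        exact ⟨t, fun p' hp => ⟨b, ht p' hp, hb0⟩⟩)
    exact ⟨max s t, fun p' hp => (key p' n hn).2 ⟨⟨a, hs p' (hp.mono (le_max_left _ _)), ha0⟩,
      fun i hi => ht i hi p' (hp.mono (le_max_right _ _))⟩⟩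

/-! ### Effectiveness of replacing the oracle instruction -/

/-- The recursion step of `toCode` on numbers of programs, at the number `n + 5`. -/
def toCodeStep (l : List Code) (n : ℕ) : Option Code :=
  l[n.div2.div2]?.bind fun s =>
  l[n.div2.div2.unpair.1]?.bind fun s₁ =>
  l[n.div2.div2.unpair.2]?.map fun s₂ =>
  cond n.bodd
    (cond n.div2.bodd (Code.rfind' s) (Code.prec s₁ s₂))
    (cond n.div2.bodd (Code.comp s₁ s₂) (Code.pair s₁ s₂))

theorem primrec₂_toCodeStep : Primrec₂ toCodeStep :=
  have m : Primrec fun p : List Code × ℕ => p.2.div2.div2 := nat_div2.comp (nat_div2.comp snd)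
  option_bind (list_getElem?.comp fst m) <| .mk <|
  option_bind ((list_getElem?.comp fst (fst.comp <| Primrec.unpair.comp m)).comp fst) <| .mk <|
  option_map ((list_getElem?.comp fst (snd.comp <| Primrec.unpair.comp m)).comp <|
    fst.comp fst) <| .mk <|
  have n := snd.comp <| fst.comp <| fst.comp fst
  have s := snd.comp (fst.comp fst)
  have s₁ := snd.comp fst
  have s₂ := snd
  (nat_bodd.comp n).cond
    ((nat_bodd.comp <| nat_div2.comp n).cond
      (Code.primrec_rfind'.comp s) (Code.primrec₂_prec.comp s₁ s₂))
    ((nat_bodd.comp <| nat_div2.comp n).cond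
      (Code.primrec₂_comp.comp s₁ s₂) (Code.primrec₂_pair.comp s₁ s₂))

/-- The recursion of `toCode` on numbers of programs. -/
def toCodeRec (q : Code) (l : List Code) : Option Code :=
  if l.length < 5 then [Code.zero, .succ, .left, .right, q][l.length]?
  else toCodeStep l (l.length - 5)

theorem primrec₂_toCodeRec : Primrec₂ toCodeRec :=
  have len : Primrec fun p : Code × List Code => p.2.length := list_length.comp snd
  Primrec.ite (nat_lt.comp len (const 5))
    (list_getElem?.comp
      (list_cons.comp (const _) <| list_cons.comp (const _) <| list_cons.comp (const _) <|
        list_cons.comp (const _) <| list_cons.comp fst (const [])) len)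
    (primrec₂_toCodeStep.comp snd (nat_sub.comp len (const 5)))

theorem toCodeRec_map_range (q : Code) (n : ℕ) :
    toCodeRec q ((List.range n).map fun n => toCode q (ofNatCode n)) =
      some (toCode q (ofNatCode n)) := by
  rw [toCodeRec, List.length_map, List.length_range]
  iterate 5 rcases n with - | n; · simp [ofNatCode, toCode]
  rw [if_neg (by omega), show n + 1 + 1 + 1 + 1 + 1 = n + 5 from rfl, Nat.add_sub_cancel]
  have hm : n.div2.div2 < n + 5 := by
    simp only [Nat.div2_val]
    omega
  have m1 : n.div2.div2.unpair.1 < n + 5 := lt_of_le_of_lt (Nat.unpair_left_le _) hm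
  have m2 : n.div2.div2.unpair.2 < n + 5 := lt_of_le_of_lt (Nat.unpair_right_le _) hm
  simp only [toCodeStep, List.getElem?_map, List.getElem?_range hm, List.getElem?_range m1,
    List.getElem?_range m2, Option.map_some, Option.bind_some, ofNatCode]
  cases n.bodd <;> cases n.div2.bodd <;> rfl

theorem primrec₂_toCode : Primrec₂ toCode :=
  ((nat_strong_rec (fun q n => toCode q (ofNatCode n)) primrec₂_toCodeRec
    toCodeRec_map_range).comp fst (encode_iff.2 snd)).of_eq fun a =>
      congrArg (toCode a.1) (ofNat_encode a.2)

/-! ### The s-m-n theorem for oracle programs -/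

theorem primrec₂_pair : Primrec₂ pair :=
  Primrec₂.ofNat_iff.2 <|
    Primrec₂.encode_iff.1 <|
      nat_add.comp
        (nat_double.comp <|
          nat_double.comp <|
            Primrec₂.natPair.comp (encode_iff.2 <| (Primrec.ofNat OracleCode).comp fst)
              (encode_iff.2 <| (Primrec.ofNat OracleCode).comp snd))
        (Primrec₂.const 5)

theorem primrec₂_comp : Primrec₂ comp :=
  Primrec₂.ofNat_iff.2 <|
    Primrec₂.encode_iff.1 <|
      nat_add.comp
        (nat_double.comp <|
          nat_double_succ.comp <|
            Primrec₂.natPair.comp (encode_iff.2 <| (Primrec.ofNat OracleCode).comp fst)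
              (encode_iff.2 <| (Primrec.ofNat OracleCode).comp snd))
        (Primrec₂.const 5)

/-- A program for a constant function. -/
protected def const : ℕ → OracleCode
  | 0 => zero
  | n + 1 => comp succ (OracleCode.const n)

/-- Fix the first argument of a program. -/
def curry (c : OracleCode) (n : ℕ) : OracleCode :=
  comp c (pair (OracleCode.const n) (pair left right))

theorem eval_comp_of_eq_some {g : ℕ → ℕ} {cf cg : OracleCode} {x y : ℕ}
    (h : eval g cg x = Part.some y) : eval g (comp cf cg) x = eval g cf y := by
  change (eval g cg x).bind _ = _
  rw [h]
  exact Part.bind_some _ _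

theorem eval_const (g : ℕ → ℕ) (m : ℕ) : ∀ n, eval g (OracleCode.const n) m = Part.some n
  | 0 => rfl
  | n + 1 => eval_comp_of_eq_some (eval_const g m n)

theorem eval_curry (g : ℕ → ℕ) (c : OracleCode) (n x : ℕ) :
    eval g (curry c n) x = eval g c (Nat.pair n x) := by
  have h : eval g (pair (OracleCode.const n) (pair left right)) x = Part.some (Nat.pair n x) := by
    simp [eval, eval_const, Seq.seq]
  exact eval_comp_of_eq_some h

theorem primrec_const : Primrec OracleCode.const :=
  (Primrec.id.nat_iterate (Primrec.const zero)
    (primrec₂_comp.comp (Primrec.const succ) Primrec.snd).to₂).of_eq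
    fun n => by
      induction n with
      | zero => rfl
      | succ n ih =>
        rw [id, Function.iterate_succ_apply', OracleCode.const]
        exact congrArg _ ih

theorem primrec₂_curry : Primrec₂ curry :=
  primrec₂_comp.comp fst <| primrec₂_pair.comp (primrec_const.comp snd) (Primrec.const _)

theorem exists_code {g : ℕ → ℕ} {f : ℕ →. ℕ} (h : Nat.RecursiveIn {(g : ℕ →. ℕ)} f) :
    ∃ c, eval g c = f := by
  induction h with
  | zero => exact ⟨zero, rfl⟩
  | succ => exact ⟨succ, rfl⟩
  | left => exact ⟨left, rfl⟩
  | right => exact ⟨right, rfl⟩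
  | oracle h hh => exact ⟨oracle, (Set.mem_singleton_iff.1 hh).symm⟩
  | pair pf pg hf hg =>
    rcases hf with ⟨cf, rfl⟩; rcases hg with ⟨cg, rfl⟩
    exact ⟨pair cf cg, rfl⟩
  | comp pf pg hf hg =>
    rcases hf with ⟨cf, rfl⟩; rcases hg with ⟨cg, rfl⟩
    exact ⟨comp cf cg, rfl⟩
  | prec pf pg hf hg =>
    rcases hf with ⟨cf, rfl⟩; rcases hg with ⟨cg, rfl⟩
    exact ⟨prec cf cg, rfl⟩
  | rfind pf hf =>
    rcases hf with ⟨cf, rfl⟩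
    -- `pair left right` computes the identity; the final `zero` starts the search of `rfind'` at
    -- `0`.
    refine ⟨comp (rfind' cf) (pair (pair left right) zero), ?_⟩
    funext x
    simp [eval, Seq.seq, pure, PFun.pure, Part.map_id']

end OracleCode

/-! ### Halting computations from finite initial segments of the oracle -/

/-- The first `s` values of `g`. -/
def restr (g : ℕ → ℕ) (s : ℕ) : List ℕ := (List.range s).map g

@[simp] theorem length_restr (g : ℕ → ℕ) (s : ℕ) : (restr g s).length = s := by simp [restr]

theorem take_restr (g : ℕ → ℕ) {s t : ℕ} (h : s ≤ t) : (restr g t).take s = restr g s := by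
  simp [restr, ← List.map_take, List.take_range, h]

theorem restr_succ (g : ℕ → ℕ) (s : ℕ) : restr g (s + 1) = restr g s ++ [g s] := by
  simp [restr, List.range_succ]

theorem mem_getElem?_restr {g : ℕ → ℕ} {s n v : ℕ} : v ∈ (restr g s)[n]? ↔ n < s ∧ g n = v := by
  simp only [restr, List.getElem?_map, Option.mem_def, Option.map_eq_some_iff]
  constructor
  · rintro ⟨a, ha, rfl⟩
    obtain ⟨h, rfl⟩ := List.getElem?_eq_some_iff.1 ha
    simpa using h
  · rintro ⟨h, rfl⟩
    exact ⟨n, List.getElem?_range h, rfl⟩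

/-- One program serves all lists, with the list as a numerical parameter; this makes `lookupCode`
primitive recursive in `σ`. -/
theorem exists_lookupCode :
    ∃ q : Code, ∀ (σ : List ℕ) (n : ℕ), q.eval (Nat.pair (encode σ) n) = (σ[n]? : Option ℕ) := by
  have h : Partrec fun p : ℕ => ((ofNat (List ℕ) p.unpair.1)[p.unpair.2]? : Part ℕ) :=
    ((list_getElem?.comp ((Primrec.ofNat (List ℕ)).comp (fst.comp unpair))
      (snd.comp unpair)).to_comp).ofOption
  obtain ⟨q, hq⟩ := Code.exists_code.1 (Partrec.nat_iff.1 h)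
  exact ⟨q, fun σ n => by rw [hq]; simp⟩

/-- A program reading off a finite list, with the list as a parameter. -/
noncomputable def lookupCode (σ : List ℕ) : Code := exists_lookupCode.choose.curry (encode σ)

theorem eval_lookupCode (σ : List ℕ) (n : ℕ) : (lookupCode σ).eval n = (σ[n]? : Option ℕ) := by
  rw [lookupCode, Code.eval_curry, exists_lookupCode.choose_spec]

theorem primrec_lookupCode : Primrec lookupCode :=
  Code.primrec₂_curry.comp (const _) Primrec.encode

/-- The `e`-th program, with some initial segment of `σ` as its oracle, is seen to halt on `x`
within a number of steps bounded in terms of the length of `σ`. -/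
def HaltsOn (σ : List ℕ) (e x : ℕ) : Prop :=
  ∃ j < σ.length + 1, (Code.evaln j.unpair.1
    ((ofNat OracleCode e).toCode (lookupCode (σ.take j.unpair.2))) x).isSome = true

theorem primrecPred_haltsOn : PrimrecPred fun p : List ℕ × ℕ × ℕ => HaltsOn p.1 p.2.1 p.2.2 := by
  have h : PrimrecRel fun (j : ℕ) (p : List ℕ × ℕ × ℕ) => (Code.evaln j.unpair.1
      ((ofNat OracleCode p.2.1).toCode (lookupCode (p.1.take j.unpair.2))) p.2.2).isSome = true :=
    Primrec.eq.comp (option_isSome.comp <| Code.primrec_evaln.comp <|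
      ((fst.comp <| unpair.comp fst).pair <| OracleCode.primrec₂_toCode.comp
        (primrec_lookupCode.comp <| list_take.comp (snd.comp <| unpair.comp fst) (fst.comp snd))
        ((Primrec.ofNat OracleCode).comp <| fst.comp <| snd.comp snd)).pair
      (snd.comp <| snd.comp snd)) (const true)
  exact (h.exists_mem_list.comp (list_range.comp <| succ.comp <| list_length.comp fst)
    Primrec.id).of_eq fun p => by simp [HaltsOn]

theorem _root_.PrimrecPred.haltsOn {α : Type*} [Primcodable α] {σ : α → List ℕ} {e x : α → ℕ}
    (hσ : Primrec σ) (he : Primrec e) (hx : Primrec x) :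
    PrimrecPred fun a => HaltsOn (σ a) (e a) (x a) :=
  primrecPred_haltsOn.comp (hσ.pair (he.pair hx))

/-- `HaltsOn` searches over codes `j` of a step bound and a segment length. A longer list only
enlarges the search, and the old witness `j` still refers to the same shorter segment. Using the
whole list each time would change the substituted program, and with it possibly the number of steps
needed. -/
theorem haltsOn_restr_mono {g : ℕ → ℕ} {s t e x : ℕ} (hst : s ≤ t)
    (h : HaltsOn (restr g s) e x) : HaltsOn (restr g t) e x := by
  obtain ⟨j, hj, h⟩ := h
  rw [length_restr] at hj
  refine ⟨j, by rw [length_restr]; omega, ?_⟩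
  have hj2 := j.unpair_right_le
  rw [take_restr g (by omega)] at h ⊢
  exact h

/-- The use principle is applied in both directions: a long enough table extends the oracle below
the use, and the oracle extends every table. -/
theorem mem_WIn_iff {X : Set ℕ} {e x : ℕ} :
    x ∈ WIn X e ↔ ∃ s, HaltsOn (restr (charFun X) s) e x := by
  have hW : x ∈ WIn X e ↔
      ((OracleCode.evalP (charFun X : ℕ →. ℕ) (ofNat OracleCode e)) x).Dom := by
    rw [OracleCode.evalP_coe]; rfl
  have ext (s n v : ℕ) : v ∈ (lookupCode (restr (charFun X) s)).eval n ↔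
      n < s ∧ charFun X n = v := by
    rw [eval_lookupCode, Part.mem_ofOption, mem_getElem?_restr]
  rw [hW]
  constructor
  · intro h
    obtain ⟨y, hy⟩ := Part.dom_iff_mem.1 h
    obtain ⟨s, hs⟩ := OracleCode.evalP_use _ _ x y hy
    have h1 := hs (lookupCode (restr (charFun X) s)).eval fun n hn v hv =>
      (ext s n v).2 ⟨hn, (Part.mem_some_iff.1 hv).symm⟩
    rw [← OracleCode.eval_toCode] at h1
    obtain ⟨k, hk⟩ := Code.evaln_complete.1 h1
    refine ⟨Nat.pair k s, Nat.pair k s, by simp, ?_⟩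
    rw [Nat.unpair_pair, take_restr _ (Nat.right_le_pair k s)]
    exact Option.isSome_iff_exists.2 ⟨y, hk⟩
  · rintro ⟨t, j, hj, h⟩
    obtain ⟨y, hy⟩ := Option.isSome_iff_exists.1 h
    have h1 := Code.evaln_sound hy
    rw [length_restr] at hj
    have hj2 := j.unpair_right_le
    rw [OracleCode.eval_toCode, take_restr _ (by omega)] at h1
    obtain ⟨s, hs⟩ := OracleCode.evalP_use _ _ x y h1
    refine Part.dom_iff_mem.2 ⟨y, hs _ fun n _ v hv => ?_⟩
    exact Part.mem_some_iff.2 ((ext _ n v).1 hv).2.symm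

/-! ### Computability relative to a set -/

section RecursiveIn

variable {O : Set (ℕ →. ℕ)} {f g : ℕ → ℕ}

theorem recursiveIn_of_computable (hf : Computable f) : Nat.RecursiveIn O (f : ℕ →. ℕ) :=
  (Partrec.nat_iff.1 hf).recursiveIn

theorem recursiveIn_comp (hf : Nat.RecursiveIn O (f : ℕ →. ℕ))
    (hg : Nat.RecursiveIn O (g : ℕ →. ℕ)) :
    Nat.RecursiveIn O ((fun n => f (g n) : ℕ → ℕ) : ℕ →. ℕ) :=
  (hf.comp hg).of_eq fun _ => Part.bind_some _ _

theorem recursiveIn_pair (hf : Nat.RecursiveIn O (f : ℕ →. ℕ))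
    (hg : Nat.RecursiveIn O (g : ℕ →. ℕ)) :
    Nat.RecursiveIn O ((fun n => Nat.pair (f n) (g n) : ℕ → ℕ) : ℕ →. ℕ) :=
  (hf.pair hg).of_eq fun _ => by simp [Seq.seq]

theorem recursiveIn_computable₂ {F : ℕ → ℕ → ℕ} (hF : Computable₂ F)
    (hf : Nat.RecursiveIn O (f : ℕ →. ℕ)) :
    Nat.RecursiveIn O ((fun n => F n (f n) : ℕ → ℕ) : ℕ →. ℕ) := by
  have hF' : Computable fun p : ℕ => F p.unpair.1 p.unpair.2 :=
    hF.comp (Computable.fst.comp Computable.unpair) (Computable.snd.comp Computable.unpair)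
  refine (recursiveIn_comp (recursiveIn_of_computable hF')
    (recursiveIn_pair (recursiveIn_of_computable Computable.id) hf)).of_eq fun n => ?_
  simp

/-- With initial segments available as numbers, the remaining work on oracle computations can be
done by ordinary primitive recursion on lists. -/
theorem recursiveIn_restr (hg : Nat.RecursiveIn O (g : ℕ →. ℕ)) :
    Nat.RecursiveIn O ((fun s => encode (restr g s) : ℕ → ℕ) : ℕ →. ℕ) := by
  have hF : Primrec₂ fun p v : ℕ =>
      encode (ofNat (List ℕ) p.unpair.2.unpair.2 ++ [v]) :=
    Primrec.encode.comp <| list_concat.comp ((Primrec.ofNat (List ℕ)).comp <|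
      snd.comp <| unpair.comp <| snd.comp <| unpair.comp fst) snd
  have hi : Primrec fun p : ℕ => p.unpair.2.unpair.1 :=
    fst.comp <| unpair.comp <| snd.comp unpair
  have hz : Primrec fun s : ℕ => Nat.pair 0 s := Primrec₂.natPair.comp (const 0) Primrec.id
  have h := ((recursiveIn_of_computable (f := fun _ => encode ([] : List ℕ))
    (Computable.const _)).prec (recursiveIn_computable₂ hF.to_comp
      (recursiveIn_comp hg (recursiveIn_of_computable hi.to_comp)))).comp
    (recursiveIn_of_computable hz.to_comp)
  refine h.of_eq fun s => (Part.bind_some _ _).trans ?_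
  simp only [Nat.unpair_pair]
  induction s with
  | zero => rfl
  | succ s ih =>
    refine (congrArg (fun x : Part ℕ => x.bind _) ih).trans ((Part.bind_some _ _).trans ?_)
    simp [restr_succ]

/-- Decision problems primitive recursive in the initial segments of `g` are computable in `g`. -/
theorem recursiveIn_charFun_of_restr (hg : Nat.RecursiveIn O (g : ℕ →. ℕ))
    {P : ℕ → List ℕ → Prop} (hP : PrimrecRel P) {r : ℕ → ℕ} (hr : Computable r) :
    Nat.RecursiveIn O (charFun {q | P q (restr g (r q))} : ℕ →. ℕ) := by
  classical
  have hF : Primrec₂ fun q τ : ℕ => if P q (ofNat (List ℕ) τ) then 1 else 0 :=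
    Primrec.ite (hP.comp fst ((Primrec.ofNat (List ℕ)).comp snd)) (const 1) (const 0)
  refine (recursiveIn_computable₂ hF.to_comp (recursiveIn_comp (recursiveIn_restr hg)
    (recursiveIn_of_computable hr))).of_eq fun q => ?_
  simp [charFun]

end RecursiveIn

section TuringReducible

variable {D X : Set ℕ}

theorem turingReducible_of_restr (hD : TuringReducible (charFun D) (charFun X))
    {P : ℕ → List ℕ → Prop} (hP : PrimrecRel P) {r : ℕ → ℕ} (hr : Computable r) :
    TuringReducible (charFun {q | P q (restr (charFun D) (r q))}) (charFun X) :=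
  RecursiveIn.iff_nat.2 (recursiveIn_charFun_of_restr (RecursiveIn.iff_nat.1 hD) hP hr)

theorem turingReducible_compl (hD : TuringReducible (charFun D) (charFun X)) :
    TuringReducible (charFun Dᶜ) (charFun X) := by
  have hF : Primrec fun v : ℕ => 1 - v := nat_sub.comp (const 1) Primrec.id
  refine RecursiveIn.iff_nat.2 ((recursiveIn_comp (recursiveIn_of_computable hF.to_comp)
    (RecursiveIn.iff_nat.1 hD)).of_eq fun n => ?_)
  by_cases h : n ∈ D <;> simp [charFun, h]

theorem turingReducible_preimage (hD : TuringReducible (charFun D) (charFun X)) {h : ℕ → ℕ}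
    (hh : Computable h) : TuringReducible (charFun {n | h n ∈ D}) (charFun X) :=
  RecursiveIn.iff_nat.2 ((recursiveIn_comp (RecursiveIn.iff_nat.1 hD)
    (recursiveIn_of_computable hh)).of_eq fun n => by simp [charFun])

/-- Uniformly computably enumerable families of sets have computable indices. -/
theorem exists_index (hD : TuringReducible (charFun D) (charFun X))
    {P : ℕ → List ℕ → Prop} (hP : PrimrecRel P) :
    ∃ h : ℕ → ℕ, Primrec h ∧
      ∀ z x, x ∈ WIn X (h z) ↔ ∃ m, P (Nat.pair z x) (restr (charFun D) m) := by
  -- The complement is taken because the unbounded search stops at value `0`.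
  have hQ := turingReducible_compl (turingReducible_of_restr hD
    (P := fun q τ => P q.unpair.1 τ) (hP.comp (fst.comp <| unpair.comp fst) snd)
    (snd.comp unpair).to_comp)
  obtain ⟨c, hc⟩ := OracleCode.exists_code (RecursiveIn.iff_nat.1 hQ).rfind
  -- The program `c` is fixed and queries the oracle; inserting the parameter `z` does not, so the
  -- index function is primitive recursive.
  refine ⟨fun z => encode (c.curry z), Primrec.encode.comp
    (OracleCode.primrec₂_curry.comp (const c) Primrec.id), fun z x => ?_⟩
  change (OracleCode.eval _ (ofNat OracleCode (encode (c.curry z))) x).Dom ↔ _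
  rw [ofNat_encode, OracleCode.eval_curry, hc]
  refine Nat.rfind_dom.trans ?_
  simp [charFun]

end TuringReducible

/-! ### Computably enumerable sets relative to an oracle -/

/-- The sets computable in `X`. -/
def ComputableInSet (X A : Set ℕ) : Prop := TuringReducible (charFun A) (charFun X)

theorem sigmaOver_one_iff {X A : Set ℕ} :
    SigmaOver (ComputableInSet X) 1 A ↔ ∃ e, A = WIn X e := by
  constructor
  · rintro ⟨B, hB, rfl⟩
    have hB' : ComputableInSet X Bᶜᶜ := turingReducible_compl hB
    rw [compl_compl] at hB'
    have hP : PrimrecRel fun (q : ℕ) (τ : List ℕ) =>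
        ∃ y < τ.length, τ[Nat.pair q.unpair.2 y]? = some 1 := by
      have h : PrimrecRel fun (y : ℕ) (p : ℕ × List ℕ) =>
          p.2[Nat.pair p.1.unpair.2 y]? = some 1 :=
        Primrec.eq.comp (list_getElem?.comp (snd.comp snd) (Primrec₂.natPair.comp
          (snd.comp <| unpair.comp <| fst.comp snd) fst)) (const _)
      exact (h.exists_mem_list.comp (list_range.comp <| list_length.comp snd)
        Primrec.id).of_eq fun p => by simp
    obtain ⟨h, -, hh⟩ := exists_index hB' hP
    refine ⟨h 0, Set.ext fun x => ?_⟩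
    rw [hh]
    have hiff (m y : ℕ) : (restr (charFun B) m)[Nat.pair x y]? = some 1 ↔
        Nat.pair x y < m ∧ Nat.pair x y ∈ B := by
      rw [← Option.mem_def, mem_getElem?_restr]
      simp [charFun]
    simp only [Set.mem_ofPred_eq, Nat.unpair_pair, length_restr, hiff]
    constructor
    · rintro ⟨y, hy⟩
      exact ⟨Nat.pair x y + 1, y, by have := Nat.right_le_pair x y; omega, by omega, hy⟩
    · rintro ⟨m, y, -, -, hy⟩
      exact ⟨y, hy⟩
  · rintro ⟨e, rfl⟩
    refine ⟨{q | HaltsOn (restr (charFun X) q.unpair.2) e q.unpair.1}, ?_, ?_⟩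
    · exact turingReducible_compl (turingReducible_of_restr (.refl _)
        (P := fun q τ => HaltsOn τ e q.unpair.1)
        (.haltsOn snd (const e) (fst.comp <| unpair.comp fst)) (snd.comp unpair).to_comp)
    · ext x
      simp [mem_WIn_iff]

/-! ### Post's theorem -/

/-- A many-one reduction to the jump: `WIn X (h x)` is everything or empty according to whether `x ∈
WIn X e`, so the diagonal question at `h x` decides this. -/
theorem computableInSet_jump_of_sigmaOver_one {X A : Set ℕ}
    (hA : SigmaOver (ComputableInSet X) 1 A) : ComputableInSet (jump X) A := by
  obtain ⟨e, rfl⟩ := sigmaOver_one_iff.1 hA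
  obtain ⟨h, hh, hmem⟩ := exists_index (X := X) (.refl _)
    (P := fun q τ => HaltsOn τ e q.unpair.1)
    (.haltsOn snd (const e) (fst.comp <| unpair.comp fst))
  have hWIn : WIn X e = {n | h n ∈ jump X} := by
    ext x
    change _ ↔ h x ∈ WIn X (h x)
    rw [hmem, mem_WIn_iff]
    simp
  rw [hWIn]
  exact turingReducible_preimage (.refl _) hh.to_comp

open Classical in
/-- The approximation of the jump of `X` computed from an initial segment `τ` of `X`, below `n`. -/
noncomputable def jumpApprox (τ : List ℕ) (n : ℕ) : List ℕ :=
  (List.range n).map fun i => if HaltsOn τ i i then 1 else 0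

theorem primrec₂_jumpApprox : Primrec₂ jumpApprox := by
  classical
  exact list_map (list_range.comp snd)
    (Primrec.ite (.haltsOn (fst.comp fst) snd snd) (const 1) (const 0))

/-- Each of the finitely many elements of the jump below `n` enters at some stage and stays; nothing
outside the jump ever enters. -/
theorem jumpApprox_restr_of_le (X : Set ℕ) (n : ℕ) :
    ∃ t, ∀ s, t ≤ s → jumpApprox (restr (charFun X) s) n = restr (charFun (jump X)) n := by
  classical
  obtain ⟨t, ht⟩ := OracleCode.exists_forall_lt_of_forall_exists
    (P := fun i t => i ∈ jump X → HaltsOn (restr (charFun X) t) i i)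
    (fun i s t hst h hi => haltsOn_restr_mono hst (h hi)) n (fun i _ => by
      by_cases hi : i ∈ jump X
      · obtain ⟨s, hs⟩ := mem_WIn_iff.1 hi
        exact ⟨s, fun _ => hs⟩
      · exact ⟨0, fun h => absurd h hi⟩)
  refine ⟨t, fun s hts => List.map_congr_left fun i hi => ?_⟩
  have h : HaltsOn (restr (charFun X) s) i i ↔ i ∈ jump X :=
    ⟨fun h => mem_WIn_iff.2 ⟨s, h⟩,
      fun h => haltsOn_restr_mono hts (ht i (List.mem_range.1 hi) h)⟩
  exact if_congr h rfl rfl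

/-- From right to left, `x ∈ WIn (jump X) e` says that some list `σ` makes the computation halt and
is an initial segment of the jump, i.e. equals its approximation at all late enough stages: an `∃∀`
statement over `X`. -/
theorem sigmaOver_two_iff {X A : Set ℕ} :
    SigmaOver (ComputableInSet X) 2 A ↔ SigmaOver (ComputableInSet (jump X)) 1 A := by
  constructor
  · rintro ⟨B, hB, rfl⟩
    exact ⟨B, computableInSet_jump_of_sigmaOver_one hB, rfl⟩
  · intro hA
    obtain ⟨e, rfl⟩ := sigmaOver_one_iff.1 hA
    -- Here `q` codes `((x, (σ, t)), s)`. `P` never reads `t` or `s`: they act only through the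
    -- stage, which is `q` itself and hence at least both.
    let P : ℕ → List ℕ → Prop := fun q τ =>
      HaltsOn (ofNat (List ℕ) q.unpair.1.unpair.2.unpair.1) e q.unpair.1.unpair.1 ∧
      jumpApprox τ (ofNat (List ℕ) q.unpair.1.unpair.2.unpair.1).length =
        ofNat (List ℕ) q.unpair.1.unpair.2.unpair.1
    have hP : PrimrecRel P := by
      have h1 : Primrec fun p : ℕ × List ℕ => p.1.unpair.1 := fst.comp <| unpair.comp fst
      have h2 : Primrec fun p : ℕ × List ℕ => ofNat (List ℕ) p.1.unpair.1.unpair.2.unpair.1 :=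
        (Primrec.ofNat (List ℕ)).comp <| fst.comp <| unpair.comp <| snd.comp <| unpair.comp h1
      exact .and (.haltsOn h2 (const e) (fst.comp <| unpair.comp h1))
        (Primrec.eq.comp (primrec₂_jumpApprox.comp snd (list_length.comp h2)) h2)
    refine ⟨{p | ∀ s, P (Nat.pair p s) (restr (charFun X) (Nat.pair p s))},
      ⟨{q | P q (restr (charFun X) q)}ᶜ, ?_, ?_⟩, ?_⟩
    · rw [compl_compl]
      exact turingReducible_of_restr (.refl _) hP Computable.id
    · ext p
      simp
    · ext x
      rw [mem_WIn_iff]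
      constructor
      · rintro ⟨n, hn⟩
        obtain ⟨t, ht⟩ := jumpApprox_restr_of_le X n
        refine ⟨Nat.pair (encode (restr (charFun (jump X)) n)) t, fun s => ?_⟩
        have hle : t ≤ Nat.pair (Nat.pair x
            (Nat.pair (encode (restr (charFun (jump X)) n)) t)) s :=
          (Nat.right_le_pair _ _).trans
            ((Nat.right_le_pair _ _).trans (Nat.left_le_pair _ _))
        simpa [P, ht _ hle] using hn
      · rintro ⟨y, hy⟩
        set σ := ofNat (List ℕ) y.unpair.1 with hσ
        obtain ⟨t, ht⟩ := jumpApprox_restr_of_le X σ.length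
        have h := hy t
        simp only [P, Nat.unpair_pair, ← hσ] at h
        rw [ht _ (Nat.right_le_pair _ _)] at h
        exact ⟨σ.length, by rw [h.2]; exact h.1⟩

theorem sigmaOver_succ_succ_iff {X : Set ℕ} (m : ℕ) : ∀ {A : Set ℕ},
    SigmaOver (ComputableInSet X) (m + 2) A ↔ SigmaOver (ComputableInSet (jump X)) (m + 1) A := by
  induction m with
  | zero => exact sigmaOver_two_iff
  | succ m ih => exact exists_congr fun B => and_congr_left' ih

theorem charFun_empty : charFun ∅ = fun _ => 0 := by
  funext n
  simp [charFun]

theorem computablePred_iff {A : Set ℕ} :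
    ComputablePred (fun x => x ∈ A) ↔ ComputableInSet ∅ A := by
  classical
  constructor
  · rintro ⟨_, h⟩
    have h' : Computable (charFun A) :=
      (Computable.cond h (Computable.const 1) (Computable.const 0)).of_eq fun n => by
        by_cases hn : n ∈ A <;> simp [charFun, hn]
    exact RecursiveIn.iff_nat.2 (recursiveIn_of_computable h')
  · intro h
    rw [ComputableInSet, charFun_empty] at h
    have h' : Computable (charFun A) := TuringReducible.partrec_of_const (s := .some 0) h
    refine Computable.computablePred ((Primrec.eq.decide.to_comp.comp h'
      (Computable.const 1)).of_eq fun n => ?_)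
    by_cases hn : n ∈ A <;> simp [charFun, hn]

theorem isPi_iff_isPiIn_empty {n : ℕ} {R : ℕ → ℕ → Prop} : IsPi n R ↔ IsPiIn ∅ n R := by
  have h : (fun A : Set ℕ => ComputablePred fun x => x ∈ A) = ComputableInSet ∅ :=
    funext fun _ => propext computablePred_iff
  rw [IsPi, h]
  rfl

theorem isPi_iff_isPiIn_emptyJump {R : ℕ → ℕ → Prop} (n m : ℕ) :
    IsPi (n + (m + 1)) R ↔ IsPiIn (emptyJump n) (m + 1) R := by
  induction n generalizing m with
  | zero => rw [Nat.zero_add]; exact isPi_iff_isPiIn_empty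
  | succ n ih =>
    rw [show n + 1 + (m + 1) = n + (m + 1 + 1) by omega, ih]
    exact sigmaOver_succ_succ_iff m

/-! ### Completeness of equality of sets computably enumerable in an oracle -/

theorem piOver_two_iff {X A : Set ℕ} : PiOver (ComputableInSet X) 2 A ↔
    ∃ D, ComputableInSet X D ∧ ∀ x, x ∈ A ↔ ∀ y, ∃ w, Nat.pair (Nat.pair x y) w ∈ D := by
  constructor
  · rintro ⟨B, ⟨D, hD, hB⟩, hA⟩
    have hD' := turingReducible_compl hD
    rw [compl_compl] at hD'
    refine ⟨D, hD', fun x => ?_⟩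
    have h1 (p : ℕ) : p ∉ B ↔ ∃ w, Nat.pair p w ∈ D := Set.ext_iff.1 hB p
    have h2 : x ∉ A ↔ ∃ y, Nat.pair x y ∈ B := Set.ext_iff.1 hA x
    rw [← not_iff_not, h2]
    simp only [not_forall, ← h1, not_not]
  · rintro ⟨D, hD, hA⟩
    refine ⟨{p | ∃ w, Nat.pair p w ∈ D}ᶜ, ⟨D, turingReducible_compl hD, compl_compl _⟩, ?_⟩
    ext x
    simp [hA]

theorem isPiIn_two_iff {X : Set ℕ} {R : ℕ → ℕ → Prop} : IsPiIn X 2 R ↔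
    ∃ D, ComputableInSet X D ∧
      ∀ a b, R a b ↔ ∀ y, ∃ w, Nat.pair (Nat.pair (Nat.pair a b) y) w ∈ D := by
  refine piOver_two_iff.trans (exists_congr fun D => and_congr_right fun _ => ⟨fun h a b => ?_,
    fun h x => ?_⟩)
  · rw [← h]
    simp [relSet]
  · rw [relSet, Set.mem_ofPred_eq, h, Nat.pair_unpair]

/-- The universal variable `y` codes `(x, s)`. The matrix compares the two sets on `x` at the stage
given by the code of the whole tuple, which is at least `s` and `w`. So `s` forces the stage past an
enumeration already seen, and `w` lets it wait for the other one. -/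
theorem isPiIn_ceEqIn (X : Set ℕ) : IsPiIn X 2 (CeEqIn X) := by
  have hP : PrimrecRel fun (q : ℕ) (τ : List ℕ) =>
      HaltsOn τ q.unpair.1.unpair.1.unpair.1 q.unpair.1.unpair.2.unpair.1 ↔
      HaltsOn τ q.unpair.1.unpair.1.unpair.2 q.unpair.1.unpair.2.unpair.1 := by
    have h1 : Primrec fun p : ℕ × List ℕ => p.1.unpair.1 := fst.comp <| unpair.comp fst
    have h2 := fst.comp <| unpair.comp h1
    have hx := fst.comp <| unpair.comp <| snd.comp <| unpair.comp h1
    have hi := PrimrecPred.haltsOn snd (fst.comp <| unpair.comp h2) hx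
    have hj := PrimrecPred.haltsOn snd (snd.comp <| unpair.comp h2) hx
    exact ((hi.and hj).or (hi.not.and hj.not)).of_eq fun p => iff_iff_and_or_not_and_not.symm
  refine isPiIn_two_iff.2 ⟨_, turingReducible_of_restr (.refl _) hP Computable.id, fun i j => ?_⟩
  simp only [Set.mem_ofPred_eq, Nat.unpair_pair, id]
  have hle (y w : ℕ) : y.unpair.2 ≤ Nat.pair (Nat.pair (Nat.pair i j) y) w :=
    y.unpair_right_le.trans ((Nat.right_le_pair _ _).trans (Nat.left_le_pair _ _))
  constructor
  · intro h y
    by_cases hy : y.unpair.1 ∈ WIn X i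
    · obtain ⟨s, hs⟩ := mem_WIn_iff.1 hy
      obtain ⟨t, ht⟩ := mem_WIn_iff.1 (show y.unpair.1 ∈ WIn X j from h ▸ hy)
      exact ⟨max s t, iff_of_true
        (haltsOn_restr_mono ((le_max_left _ _).trans (Nat.right_le_pair _ _)) hs)
        (haltsOn_restr_mono ((le_max_right _ _).trans (Nat.right_le_pair _ _)) ht)⟩
    · exact ⟨0, iff_of_false (fun hs => hy (mem_WIn_iff.2 ⟨_, hs⟩))
        (fun hs => hy (show _ ∈ WIn X i from (show WIn X i = WIn X j from h) ▸
          mem_WIn_iff.2 ⟨_, hs⟩))⟩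
  · intro h
    ext x
    constructor
    · intro hx
      obtain ⟨s, hs⟩ := mem_WIn_iff.1 hx
      obtain ⟨w, hw⟩ := h (Nat.pair x s)
      have hs' := haltsOn_restr_mono ((by simp : s ≤ (Nat.pair x s).unpair.2).trans
        (hle (Nat.pair x s) w)) hs
      rw [Nat.unpair_pair] at hw
      exact mem_WIn_iff.2 ⟨_, hw.1 hs'⟩
    · intro hx
      obtain ⟨s, hs⟩ := mem_WIn_iff.1 hx
      obtain ⟨w, hw⟩ := h (Nat.pair x s)
      have hs' := haltsOn_restr_mono ((by simp : s ≤ (Nat.pair x s).unpair.2).trans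
        (hle (Nat.pair x s) w)) hs
      rw [Nat.unpair_pair] at hw
      exact mem_WIn_iff.2 ⟨_, hw.2 hs'⟩

theorem equivalence_ceEqIn (X : Set ℕ) : Equivalence (CeEqIn X) :=
  ⟨fun _ => rfl, fun h => h.symm, fun h₁ h₂ => h₁.trans h₂⟩

/-! ### The finitary reduction -/

/-- With `τ` an initial segment of `D`, it is seen that `∃ w, ⟨⟨⟨a, b⟩, y⟩, w⟩ ∈ D` holds for all
`y < n`. -/
def Agrees (τ : List ℕ) (a b n : ℕ) : Prop :=
  ∀ y < n, ∃ w < τ.length, τ[Nat.pair (Nat.pair (Nat.pair a b) y) w]? = some 1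

theorem _root_.PrimrecPred.agrees {α : Type*} [Primcodable α] {τ : α → List ℕ} {a b n : α → ℕ}
    (hτ : Primrec τ) (ha : Primrec a) (hb : Primrec b) (hn : Primrec n) :
    PrimrecPred fun x => Agrees (τ x) (a x) (b x) (n x) := by
  have h1 : PrimrecRel fun (w : ℕ) (p : ℕ × α) =>
      (τ p.2)[Nat.pair (Nat.pair (Nat.pair (a p.2) (b p.2)) p.1) w]? = some 1 :=
    have hx := snd.comp snd
    Primrec.eq.comp (list_getElem?.comp (hτ.comp hx) (Primrec₂.natPair.comp (Primrec₂.natPair.comp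
      (Primrec₂.natPair.comp (ha.comp hx) (hb.comp hx)) (fst.comp snd)) fst)) (const _)
  have h2 : PrimrecRel fun (y : ℕ) (x : α) => ∃ w < (τ x).length,
      (τ x)[Nat.pair (Nat.pair (Nat.pair (a x) (b x)) y) w]? = some 1 :=
    (h1.exists_mem_list.comp (list_range.comp <| list_length.comp <| hτ.comp snd)
      Primrec.id).of_eq fun p => by simp
  exact (h2.forall_mem_list.comp (list_range.comp hn) Primrec.id).of_eq fun p => by simp [Agrees]

theorem exists_agrees_iff {D : Set ℕ} {a b n : ℕ} :
    (∃ m, Agrees (restr (charFun D) m) a b n) ↔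
      ∀ y < n, ∃ w, Nat.pair (Nat.pair (Nat.pair a b) y) w ∈ D := by
  have hiff (m p : ℕ) : (restr (charFun D) m)[p]? = some 1 ↔ p < m ∧ p ∈ D := by
    rw [← Option.mem_def, mem_getElem?_restr]
    simp [charFun]
  simp only [Agrees, length_restr, hiff]
  constructor
  · rintro ⟨m, h⟩ y hy
    obtain ⟨w, -, -, hw⟩ := h y hy
    exact ⟨w, hw⟩
  · intro h
    refine OracleCode.exists_forall_lt_of_forall_exists (fun y s t hst => ?_) n fun y hy => ?_
    · rintro ⟨w, hw, hlt, hD⟩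
      exact ⟨w, hw.trans_le hst, hlt.trans_le hst, hD⟩
    · obtain ⟨w, hw⟩ := h y hy
      refine ⟨Nat.pair (Nat.pair (Nat.pair a b) y) w + 1, w, ?_, by omega, hw⟩
      have := Nat.right_le_pair (Nat.pair (Nat.pair a b) y) w
      omega

/-- The set of codes of pairs `(S, n)` that is assigned to the entry `x` of the list `L`: the code
of `(S, n)` is enumerated at once if `x ∈ S`, and otherwise as soon as the list `S` is seen not to
be closed in `L` up to `n`. -/
def Enumerates (τ L : List ℕ) (x : ℕ) (S : List ℕ) (n : ℕ) : Prop :=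
  x ∈ S ∨ ∃ a ∈ S, ∃ b ∈ L, b ∉ S ∧ Agrees τ a b n

theorem primrecRel_mem_list : PrimrecRel fun (x : ℕ) (S : List ℕ) => x ∈ S :=
  (Primrec.eq.exists_mem_list.comp snd fst).of_eq fun p => by simp

theorem _root_.PrimrecPred.enumerates {α : Type*} [Primcodable α] {τ L S : α → List ℕ}
    {x n : α → ℕ} (hτ : Primrec τ) (hL : Primrec L) (hx : Primrec x) (hS : Primrec S)
    (hn : Primrec n) : PrimrecPred fun p => Enumerates (τ p) (L p) (x p) (S p) (n p) := by
  have h1 : PrimrecRel fun (b : ℕ) (p : ℕ × α) => b ∉ S p.2 ∧ Agrees (τ p.2) p.1 b (n p.2) :=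
    have hp := snd.comp snd
    .and (primrecRel_mem_list.comp fst (hS.comp hp)).not
      (.agrees (hτ.comp hp) (fst.comp snd) fst (hn.comp hp))
  have h2 : PrimrecRel fun (a : ℕ) (p : α) => ∃ b ∈ L p, b ∉ S p ∧ Agrees (τ p) a b (n p) :=
    h1.exists_mem_list.comp (hL.comp snd) Primrec.id
  exact .or (primrecRel_mem_list.comp hx hS) (h2.exists_mem_list.comp hS Primrec.id)

theorem exists_enumerates_iff {D : Set ℕ} {L S : List ℕ} {x n : ℕ} :
    (∃ m, Enumerates (restr (charFun D) m) L x S n) ↔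
      x ∈ S ∨ ∃ a ∈ S, ∃ b ∈ L, b ∉ S ∧
        ∀ y < n, ∃ w, Nat.pair (Nat.pair (Nat.pair a b) y) w ∈ D := by
  simp only [Enumerates, ← exists_agrees_iff]
  constructor
  · rintro ⟨m, h | ⟨a, ha, b, hb, hbS, h⟩⟩
    · exact .inl h
    · exact .inr ⟨a, ha, b, hb, hbS, m, h⟩
  · rintro (h | ⟨a, ha, b, hb, hbS, m, h⟩)
    · exact ⟨0, .inl h⟩
    · exact ⟨m, .inr ⟨a, ha, b, hb, hbS, h⟩⟩

/-- A reduction of the entries of finite sequences, computable in the sequence and the entry, is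
a finitary reduction. -/
theorem finitarilyReducible_of_list {E F : ℕ → ℕ → Prop} {h : List ℕ → ℕ → ℕ}
    (hh : Primrec₂ h) (H : ∀ L, ∀ x ∈ L, ∀ y ∈ L, E x y ↔ F (h L x) (h L y)) :
    FinitarilyReducible E F := by
  refine ⟨fun n v => v.map (h v.toList), ?_, fun n v i j _ => ?_⟩
  · exact (list_map Primrec.id hh).to_comp.of_eq fun L =>
      (List.Vector.toList_map ⟨L, rfl⟩ (h L)).symm
  · simp only [List.Vector.get_map]
    exact H _ _ (by simp) _ (by simp)

theorem finitarilyReducible_ceEqIn {X : Set ℕ} {R : ℕ → ℕ → Prop} (hR : Equivalence R)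
    (hPi : IsPiIn X 2 R) : FinitarilyReducible R (CeEqIn X) := by
  obtain ⟨D, hD, hRD⟩ := isPiIn_two_iff.1 hPi
  have hP : PrimrecRel fun (q : ℕ) (τ : List ℕ) => Enumerates τ
      (ofNat (List ℕ) q.unpair.1.unpair.1) q.unpair.1.unpair.2
      (ofNat (List ℕ) q.unpair.2.unpair.1) q.unpair.2.unpair.2 := by
    have h1 : Primrec fun p : ℕ × List ℕ => p.1.unpair.1 := fst.comp <| unpair.comp fst
    have h2 : Primrec fun p : ℕ × List ℕ => p.1.unpair.2 := snd.comp <| unpair.comp fst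
    exact .enumerates snd ((Primrec.ofNat _).comp <| fst.comp <| unpair.comp h1)
      (snd.comp <| unpair.comp h1) ((Primrec.ofNat _).comp <| fst.comp <| unpair.comp h2)
      (snd.comp <| unpair.comp h2)
  obtain ⟨h, hh, hmem⟩ := exists_index hD hP
  simp only [Nat.unpair_pair, exists_enumerates_iff] at hmem
  refine finitarilyReducible_of_list (h := fun L x => h (Nat.pair (encode L) x))
    (hh.comp <| Primrec₂.natPair.comp (Primrec.encode.comp fst) snd) fun L x hx x' hx' => ?_
  have hsub : ∀ x, ∀ x' ∈ L, R x x' →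
      WIn X (h (Nat.pair (encode L) x)) ⊆ WIn X (h (Nat.pair (encode L) x')) := by
    intro x x' hx' hxx' v hv
    simp only [hmem, Nat.unpair_pair, ofNat_encode] at hv ⊢
    rcases hv with hv | hv
    · by_cases hv' : x' ∈ ofNat (List ℕ) v.unpair.1
      · exact .inl hv'
      -- `S` separates the related entries `x` and `x'`, so they themselves show that `S` is not
      -- closed.
      · exact .inr ⟨x, hv, x', hx', hv', fun y _ => (hRD x x').1 hxx' y⟩
    · exact .inr hv
  constructor
  · exact fun hxx' => (hsub x x' hx' hxx').antisymm (hsub x' x hx (hR.symm hxx'))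
  · classical
    intro heq
    by_contra hxx'
    set S := L.filter fun a => R x a with hS
    have hmS (a : ℕ) : a ∈ S ↔ a ∈ L ∧ R x a := by simp [hS]
    -- A bound past some point of disagreement of `a` and `b`; related pairs get the harmless value
    -- `0`.
    have hbound (a b : ℕ) : ∃ n, ¬R a b → ∃ y < n,
        ¬∃ w, Nat.pair (Nat.pair (Nat.pair a b) y) w ∈ D := by
      by_cases hab : R a b
      · exact ⟨0, fun h => absurd hab h⟩
      · obtain ⟨y, hy⟩ := not_forall.1 (fun H => hab ((hRD a b).2 H))
        exact ⟨y + 1, fun _ => ⟨y, by omega, hy⟩⟩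
    choose N hN using hbound
    let n := (L.toFinset ×ˢ L.toFinset).sup fun p => N p.1 p.2
    -- The separating pair: `S` is the class of `x` in `L`, so leaving `S` inside `L` means leaving
    -- the class, which `n` is large enough to detect.
    have hx'W : Nat.pair (encode S) n ∈ WIn X (h (Nat.pair (encode L) x')) := by
      rw [← show WIn X (h (Nat.pair (encode L) x)) = _ from heq, hmem]
      left
      simpa [hmS, hx] using hR.refl x
    simp only [hmem, Nat.unpair_pair, ofNat_encode] at hx'W
    rcases hx'W with hx'S | ⟨a, ha, b, hb, hbS, hall⟩
    · exact hxx' ((hmS _).1 hx'S).2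
    · have ha' := (hmS _).1 ha
      have hab : ¬R a b := fun hab => hbS ((hmS _).2 ⟨hb, hR.trans ha'.2 hab⟩)
      obtain ⟨y, hy, hne⟩ := hN a b hab
      have hle : N a b ≤ n := Finset.le_sup (f := fun p : ℕ × ℕ => N p.1 p.2) (b := (a, b))
        (by simp [ha'.1, hb])
      exact hne (hall y (hy.trans_le hle))

theorem finitarilyComplete_ceEqIn (X : Set ℕ) : FinitarilyComplete (IsPiIn X 2) (CeEqIn X) :=
  ⟨equivalence_ceEqIn X, isPiIn_ceEqIn X, fun _ => finitarilyReducible_ceEqIn⟩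

/-! ### The unrelativized numbering -/

theorem exists_WIn_empty_eq_W : ∃ t : ℕ → ℕ, Primrec t ∧ ∀ e, WIn ∅ (t e) = W e := by
  have hP : PrimrecRel fun (q : ℕ) (τ : List ℕ) =>
      (Code.evaln τ.length (ofNat Code q.unpair.1) q.unpair.2).isSome = true :=
    Primrec.eq.comp (option_isSome.comp <| Code.primrec_evaln.comp <|
      ((list_length.comp snd).pair <| (Primrec.ofNat Code).comp <| fst.comp <| unpair.comp fst).pair
        (snd.comp <| unpair.comp fst)) (const true)
  obtain ⟨t, ht, hmem⟩ := exists_index (D := ∅) (X := ∅) (.refl _) hP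
  refine ⟨t, ht, fun e => Set.ext fun x => ?_⟩
  rw [hmem, W, PFun.mem_dom]
  simp only [Nat.unpair_pair, length_restr, Code.evaln_complete, Option.isSome_iff_exists]
  exact exists_comm

/-- The initial segments of the empty oracle are lists of zeros, so the search for a halting stage
is an ordinary partial computable function. -/
theorem exists_W_eq_WIn_empty : ∃ u : ℕ → ℕ, Primrec u ∧ ∀ e, W (u e) = WIn ∅ e := by
  classical
  have hr : Primrec (restr (charFun ∅)) := by
    rw [charFun_empty]
    exact list_map list_range (const 0).to₂
  have hP : PrimrecRel fun (p : ℕ) (s : ℕ) =>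
      HaltsOn (restr (charFun ∅) s) p.unpair.1 p.unpair.2 :=
    .haltsOn (hr.comp snd) (fst.comp <| unpair.comp fst) (snd.comp <| unpair.comp fst)
  have hf : Partrec fun p : ℕ => Nat.rfind fun s =>
      Part.some (decide (HaltsOn (restr (charFun ∅) s) p.unpair.1 p.unpair.2)) :=
    Partrec.rfind hP.decide.to_comp
  obtain ⟨c, hc⟩ := Code.exists_code.1 (Partrec.nat_iff.1 hf)
  refine ⟨fun e => encode (c.curry e), Primrec.encode.comp
    (Code.primrec₂_curry.comp (const c) Primrec.id), fun e => Set.ext fun x => ?_⟩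
  rw [mem_WIn_iff]
  change (Code.eval (ofNat Code (encode (c.curry e))) x).Dom ↔ _
  rw [ofNat_encode, Code.eval_curry, hc]
  refine Nat.rfind_dom.trans ?_
  simp

/-- The translation `t` pulls the `Π₂` definition back to `W`; composing with `u` carries the
reductions over. -/
theorem finitarilyComplete_ceEq : FinitarilyComplete (IsPi 2) CeEq := by
  obtain ⟨t, ht, htW⟩ := exists_WIn_empty_eq_W
  obtain ⟨u, hu, huW⟩ := exists_W_eq_WIn_empty
  refine ⟨⟨fun _ => rfl, fun h => h.symm, fun h₁ h₂ => h₁.trans h₂⟩, ?_, fun R hR hPi => ?_⟩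
  · obtain ⟨D, hD, h⟩ := isPiIn_two_iff.1 (isPiIn_ceEqIn ∅)
    let k : ℕ → ℕ := fun q => Nat.pair (Nat.pair (Nat.pair (t q.unpair.1.unpair.1.unpair.1)
      (t q.unpair.1.unpair.1.unpair.2)) q.unpair.1.unpair.2) q.unpair.2
    have hk : Computable k := by
      have h1 : Primrec fun q : ℕ => q.unpair.1 := fst.comp unpair
      have h2 := h1.comp h1
      exact (Primrec₂.natPair.comp (Primrec₂.natPair.comp
        (Primrec₂.natPair.comp (ht.comp <| fst.comp <| unpair.comp h2)
          (ht.comp <| snd.comp <| unpair.comp h2)) (snd.comp <| unpair.comp h1))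
        (snd.comp unpair)).to_comp
    refine isPi_iff_isPiIn_empty.2 (isPiIn_two_iff.2
      ⟨_, turingReducible_preimage hD hk, fun a b => ?_⟩)
    have hab : CeEq a b ↔ CeEqIn ∅ (t a) (t b) := by rw [CeEq, CeEqIn, htW, htW]
    rw [hab, h]
    simp [k]
  · obtain ⟨f, hf, hred⟩ := finitarilyReducible_ceEqIn hR (isPi_iff_isPiIn_empty.1 hPi)
    refine ⟨fun n v => (f n v).map u, ?_, fun n v i j hij => ?_⟩
    · exact ((list_map Primrec.id (hu.comp snd).to₂).to_comp.comp hf).of_eq fun x =>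
        (List.Vector.toList_map _ _).symm
    · rw [hred n v i j hij, List.Vector.get_map, List.Vector.get_map, CeEq, CeEqIn, huW, huW]

end FinitaryReducibility

theorem mainTheorem1 :
    FinitaryReducibility.FinitarilyComplete (FinitaryReducibility.IsPi 2)
        FinitaryReducibility.CeEq ∧
      (∀ X : Set ℕ,
        FinitaryReducibility.FinitarilyComplete (FinitaryReducibility.IsPiIn X 2)
          (FinitaryReducibility.CeEqIn X)) ∧
      ∀ n : ℕ,
        FinitaryReducibility.FinitarilyComplete (FinitaryReducibility.IsPi (n + 2))
          (FinitaryReducibility.CeEqLevel n) := by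
  refine ⟨FinitaryReducibility.finitarilyComplete_ceEq,
    FinitaryReducibility.finitarilyComplete_ceEqIn, fun n => ?_⟩
  rw [show FinitaryReducibility.IsPi (n + 2) =
      FinitaryReducibility.IsPiIn (FinitaryReducibility.emptyJump n) 2 from
    funext fun _ => propext (FinitaryReducibility.isPi_iff_isPiIn_emptyJump n 1)]
  exact FinitaryReducibility.finitarilyComplete_ceEqIn _
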